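/- Let $V$ be a countable set of propositional variables and let $\mathcal{L}_{\Box\Diamond}(V)$ be the set of formulas built from $V$ and the constant $\bot$ with the binary connectives $\wedge,\vee,\rightarrow$ and the unary operators $\Box,\Diamond$; put $\top:=\bot\rightarrow\bot$ and $\neg\varphi:=\varphi\rightarrow\bot$. The axiomatic system $\mathcal{GK}^c$ has the following axiom schemes (for all formulas $\varphi,\psi,\chi$ of $\mathcal{L}_{\Box\Diamond}(V)$): the axioms of propositional Gödel logic - $\varphi\rightarrow(\psi\rightarrow\varphi)$; $(\varphi\wedge\psi)\rightarrow\varphi$; $(\varphi\wedge\psi)\rightarrow\psi$; $\varphi\rightarrow(\psi\rightarrow(\varphi\wedge\psi))$; $(\bot\rightarrow\varphi)\wedge(\varphi\rightarrow\top)$; $\varphi\rightarrow(\varphi\vee\psi)$; $\psi\rightarrow(\varphi\vee\psi)$; - $(\varphi\rightarrow\psi)\rightarrow((\chi\rightarrow\varphi)\rightarrow(\chi\rightarrow\psi))$; $(\varphi\rightarrow(\psi\rightarrow\chi))\rightarrow(\psi\rightarrow(\varphi\rightarrow\chi))$; $((\varphi\rightarrow\chi)\wedge(\psi\rightarrow\chi))\rightarrow((\varphi\vee\psi)\rightarrow\chi)$;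 $(\varphi\rightarrow(\psi\rightarrow\chi))\rightarrow((\varphi\wedge\psi)\rightarrow\chi)$; $((\chi\rightarrow\varphi)\wedge(\chi\rightarrow\psi))\rightarrow(\chi\rightarrow(\varphi\wedge\psi))$; $(\varphi\rightarrow(\varphi\rightarrow\psi))\rightarrow(\varphi\rightarrow\psi)$; - prelinearity $(\varphi\rightarrow\psi)\vee(\psi\rightarrow\varphi)$; and the modal axioms - $(K_\Box)$ $\Box(\varphi\rightarrow\psi)\rightarrow(\Box\varphi\rightarrow\Box\psi)$; $(K_\Diamond)$ $\Diamond(\varphi\vee\psi)\rightarrow(\Diamond\varphi\vee\Diamond\psi)$; $(FS1)$ $\Diamond(\varphi\rightarrow\psi)\rightarrow(\Box\varphi\rightarrow\Diamond\psi)$; $(FS2)$ $(\Diamond\varphi\rightarrow\Box\psi)\rightarrow\Box(\varphi\rightarrow\psi)$; $(F_\Diamond)$ $\neg\Diamond\bot$; - $(Cr)$ $\Box(\varphi\vee\psi)\rightarrow(\Box\varphi\vee\Diamond\psi)$. Its rules are modus ponens ($\varphi,\varphi\rightarrow\psi\vdash\psi$) and two rules that apply to theorems only (formulas derivable from $\emptyset$):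 $\vdash\varphi$ implies $\vdash\Box\varphi$, and $\vdash\varphi\rightarrow\psi$ implies $\vdash\Diamond\varphi\rightarrow\Diamond\psi$. Write $\Gamma\vdash_{\mathcal{GK}^c}\varphi$ if $\varphi$ is derivable from premises in $\Gamma$ in this system. A crisp Gödel–Kripke model is a triple $\langle W,R,e\rangle$ with $W$ a non-empty set, $R\colon W\times W\to\{0,1\}$ and $e\colon V\times W\to[0,1]$. On $[0,1]$ let $\wedge,\vee$ be minimum and maximum, and let $a\rightarrow b=1$ if $a\le b$ and $a\rightarrow b=b$ otherwise. Then $e$ extends to $W\times\mathcal{L}_{\Box\Diamond}(V)$ by setting $e(v,p)=e(p,v)$ for $p\in V$, $e(v,\bot)=0$, $e(v,\varphi\star\psi)=e(v,\varphi)\star e(v,\psi)$ for $\star\in\{\wedge,\vee,\rightarrow\}$, $e(v,\Box\varphi)=\inf_{w\in W}(R(v,w)\rightarrow e(w,\varphi))$ and $e(v,\Diamond\varphi)=\sup_{w\in W}(R(v,w)\wedge e(w,\varphi))$. Write $\Gamma\models_{\mathbf{GK}^c}\varphi$ if for every crisp Gödel–Kripke model and every world $v$ of it, $e(v,\gamma)=1$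 for all $\gamma\in\Gamma$ implies $e(v,\varphi)=1$. **Strong completeness.** For every (finite or infinite, necessarily countable) set of formulas $\Gamma\subseteq\mathcal{L}_{\Box\Diamond}(V)$ and every formula $\varphi\in\mathcal{L}_{\Box\Diamond}(V)$, $$\Gamma\vdash_{\mathcal{GK}^c}\varphi\quad\text{if and only if}\quad\Gamma\models_{\mathbf{GK}^c}\varphi .$$ -/

import Mathlib

universe u v

namespace GodelModal

/-- Formulas of the bimodal language `L_{□◇}(V)` over the propositional variables `V`. -/
inductive Formula (V : Type*) where
  | var : V → Formula V
  | bot : Formula V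
  | and : Formula V → Formula V → Formula V
  | or : Formula V → Formula V → Formula V
  | imp : Formula V → Formula V → Formula V
  | box : Formula V → Formula V
  | dia : Formula V → Formula V

namespace Formula

/-- `⊤ := ⊥ → ⊥`. -/
def top {V : Type*} : Formula V := bot.imp bot

/-- `¬ φ := φ → ⊥`. -/
def neg {V : Type*} (φ : Formula V) : Formula V := φ.imp bot

end Formula

/-- Axioms of the propositional Gödel calculus (with all substitution instances in the bimodal
language). -/
inductive GAxiom {V : Type*} : Formula V → Prop where
  | a1 (φ ψ : Formula V) : GAxiom (φ.imp (ψ.imp φ))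
  | a2 (φ ψ : Formula V) : GAxiom ((φ.and ψ).imp φ)
  | a3 (φ ψ : Formula V) : GAxiom ((φ.and ψ).imp ψ)
  | a4 (φ ψ : Formula V) : GAxiom (φ.imp (ψ.imp (φ.and ψ)))
  | a5 (φ : Formula V) : GAxiom ((Formula.bot.imp φ).and (φ.imp Formula.top))
  | a6 (φ ψ : Formula V) : GAxiom (φ.imp (φ.or ψ))
  | a7 (φ ψ : Formula V) : GAxiom (ψ.imp (φ.or ψ))
  | a8 (φ ψ χ : Formula V) : GAxiom ((φ.imp ψ).imp ((χ.imp φ).imp (χ.imp ψ)))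
  | a9 (φ ψ χ : Formula V) : GAxiom ((φ.imp (ψ.imp χ)).imp (ψ.imp (φ.imp χ)))
  | a10 (φ ψ χ : Formula V) : GAxiom (((φ.imp χ).and (ψ.imp χ)).imp ((φ.or ψ).imp χ))
  | a11 (φ ψ χ : Formula V) : GAxiom ((φ.imp (ψ.imp χ)).imp ((φ.and ψ).imp χ))
  | a12 (φ ψ χ : Formula V) : GAxiom (((χ.imp φ).and (χ.imp ψ)).imp (χ.imp (φ.and ψ)))
  | a13 (φ ψ : Formula V) : GAxiom ((φ.imp (φ.imp ψ)).imp (φ.imp ψ))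
  /-- Prelinearity. -/
  | a14 (φ ψ : Formula V) : GAxiom ((φ.imp ψ).or (ψ.imp φ))

/-- Axioms of `GK`: the Gödel axioms and the modal axioms of Fischer Servi's `IK`. -/
inductive GKAxiom {V : Type*} : Formula V → Prop where
  | prop {φ : Formula V} : GAxiom φ → GKAxiom φ
  | kBox (φ ψ : Formula V) : GKAxiom ((φ.imp ψ).box.imp (φ.box.imp ψ.box))
  | kDia (φ ψ : Formula V) : GKAxiom ((φ.or ψ).dia.imp (φ.dia.or ψ.dia))
  | fs1 (φ ψ : Formula V) : GKAxiom ((φ.imp ψ).dia.imp (φ.box.imp ψ.dia))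
  | fs2 (φ ψ : Formula V) : GKAxiom ((φ.dia.imp ψ.box).imp (φ.imp ψ).box)
  | fDia : GKAxiom (Formula.bot.dia.neg)

/-- Axioms of `GK^c`: those of `GK` and `(Cr) : □(φ ∨ ψ) → (□φ ∨ ◇ψ)`. -/
inductive GKcAxiom {V : Type*} : Formula V → Prop where
  | gk {φ : Formula V} : GKAxiom φ → GKcAxiom φ
  | cr (φ ψ : Formula V) : GKcAxiom ((φ.or ψ).box.imp (φ.box.or ψ.dia))

/-- `Derivable Γ φ` is `Γ ⊢_{GK^c} φ`: derivability by modus ponens and the two modal rules,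
which apply to theorems (formulas derivable from `∅`) only. -/
inductive Derivable {V : Type*} : Set (Formula V) → Formula V → Prop where
  | hyp {Γ : Set (Formula V)} {φ : Formula V} : φ ∈ Γ → Derivable Γ φ
  | ax {Γ : Set (Formula V)} {φ : Formula V} : GKcAxiom φ → Derivable Γ φ
  | mp {Γ : Set (Formula V)} {φ ψ : Formula V} :
      Derivable Γ φ → Derivable Γ (φ.imp ψ) → Derivable Γ ψ
  | necBox {Γ : Set (Formula V)} {φ : Formula V} :
      Derivable ∅ φ → Derivable Γ φ.box
  | necDia {Γ : Set (Formula V)} {φ ψ : Formula V} :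
      Derivable ∅ (φ.imp ψ) → Derivable Γ (φ.dia.imp ψ.dia)

/-- The implication of the standard Gödel algebra on `[0,1]`. -/
noncomputable def gimp (a b : unitInterval) : unitInterval := if a ≤ b then 1 else b

/-- Gödel–Kripke models over the set of worlds `W`. -/
structure Model (V W : Type*) where
  /-- The `[0,1]`-valued accessibility relation. -/
  R : W → W → unitInterval
  /-- The evaluation of variables at worlds. -/
  e : V → W → unitInterval

/-- A model is crisp if its accessibility relation takes only the values `0` and `1`. -/
def Model.IsCrisp {V W : Type*} (M : Model V W) : Prop :=
  ∀ v w : W, M.R v w = 0 ∨ M.R v w = 1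

/-- The value of a formula at a world; infima and suprema are taken in `[0,1]`. -/
noncomputable def Model.eval {V W : Type*} (M : Model V W) : W → Formula V → unitInterval
  | v, .var p => M.e p v
  | _, .bot => 0
  | v, .and φ ψ => M.eval v φ ⊓ M.eval v ψ
  | v, .or φ ψ => M.eval v φ ⊔ M.eval v ψ
  | v, .imp φ ψ => gimp (M.eval v φ) (M.eval v ψ)
  | v, .box φ => ⨅ w : W, gimp (M.R v w) (M.eval w φ)
  | v, .dia φ => ⨆ w : W, M.R v w ⊓ M.eval w φ

/-- `LocalConsequence Γ φ` is `Γ ⊨_{GK^c} φ`: local consequence over all crisp Gödel–Kripke models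
(with a non-empty set of worlds, in an arbitrary universe). -/
def LocalConsequence {V : Type u} (Γ : Set (Formula V)) (φ : Formula V) : Prop :=
  ∀ (W : Type v) [Nonempty W] (M : Model V W), M.IsCrisp →
    ∀ v : W, (∀ γ ∈ Γ, M.eval v γ = 1) → M.eval v φ = 1

end GodelModal

/-!
Soundness is an induction on derivations. For completeness, suppose `Γ ⊬ φ`. The difficulty is
that infima and suprema over accessible worlds need not be attained, and that a countable set of
values in the real interval `[0,1]` may have cuts that leave no room for the values of an accessible
world. Worlds are therefore first taken to be valuations in the unit interval of the hyperrationals,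
where every countable cut contains a copy of `ℚ` (`HyperRat.exists_strictMono_between`).

Let `v` be such a world, with `w` accessible from `v` when `v (□a) ≤ w a ≤ v (◇a)` for all `a`. If
`v (□φ) < d ≤ 1`, an accessible world `w` with `w φ < d` is found in two steps. Axiom `(Cr)` gives a
prime theory `T` that contains `{a | v (□a) = 1}` and avoids `{a | v (◇a) < 1}` and all `b → φ` with
`v (□φ) < v (□b)` (`IsWorld.exists_isPrimeTheory`). By `(FS1)` and `(FS2)` the comparisons demanded
by accessibility are then consistent both with the order of the values of `v` and with the order
`a → b ∈ T` of formulas, so the two chains can be amalgamated inside the hyperrationals without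
moving the values of `v` (`HyperRat.exists_placement`, `IsWorld.exists_accessible`). The case of `◇`
is dual.

A Löwenheim–Skolem closure (`exists_isWitnessed`) then produces countably many worlds and a
countable dense chain `D` of truth values in which `v (□φ)` and `v (◇φ)` are the infimum and the
supremum over accessible worlds. Cantor's isomorphism theorem embeds `D` into `[0,1]` with dense
image (`exists_dense_embedding`); such an embedding preserves these infima and suprema, which gives
the truth lemma `eval_canonicalModel`.
-/

namespace GodelModal

/-! ### Derivations and prime theories -/

variable {V : Type u}

theorem countable_formula [Countable V] : Countable (Formula V) := by
  obtain ⟨f, hf⟩ := exists_injective_nat V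
  let g : Formula V → ℕ := fun φ => Formula.rec (motive := fun _ => ℕ)
    (fun p => Nat.pair 0 (f p)) (Nat.pair 1 0)
    (fun _ _ m n => Nat.pair 2 (Nat.pair m n)) (fun _ _ m n => Nat.pair 3 (Nat.pair m n))
    (fun _ _ m n => Nat.pair 4 (Nat.pair m n)) (fun _ m => Nat.pair 5 m)
    (fun _ m => Nat.pair 6 m) φ
  have hg : Function.Injective g := by
    intro φ
    induction φ with
    | var p => intro ψ h; cases ψ <;> simp_all [g, Nat.pair_eq_pair, hf.eq_iff]
    | bot => intro ψ h; cases ψ <;> simp_all [g, Nat.pair_eq_pair]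
    | and a b iha ihb =>
      intro ψ h
      cases ψ <;> simp [g, Nat.pair_eq_pair] at h
      exact congrArg₂ _ (iha h.1) (ihb h.2)
    | or a b iha ihb =>
      intro ψ h
      cases ψ <;> simp [g, Nat.pair_eq_pair] at h
      exact congrArg₂ _ (iha h.1) (ihb h.2)
    | imp a b iha ihb =>
      intro ψ h
      cases ψ <;> simp [g, Nat.pair_eq_pair] at h
      exact congrArg₂ _ (iha h.1) (ihb h.2)
    | box a iha =>
      intro ψ h
      cases ψ <;> simp [g, Nat.pair_eq_pair] at h
      exact congrArg _ (iha h)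
    | dia a iha =>
      intro ψ h
      cases ψ <;> simp [g, Nat.pair_eq_pair] at h
      exact congrArg _ (iha h)
  exact hg.countable

namespace Derivable

variable {Γ Δ : Set (Formula V)} {φ ψ χ : Formula V}

theorem gax (h : GAxiom φ) : Derivable Γ φ := ax (.gk (.prop h))

theorem mono (hΓ : Γ ⊆ Δ) (h : Derivable Γ φ) : Derivable Δ φ := by
  induction h with
  | hyp h => exact hyp (hΓ h)
  | ax h => exact ax h
  | mp _ _ ih₁ ih₂ => exact mp (ih₁ hΓ) (ih₂ hΓ)
  | necBox h => exact necBox h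
  | necDia h => exact necDia h

theorem weaken (h : Derivable ∅ φ) : Derivable Γ φ := h.mono (Set.empty_subset _)

theorem imp_self : Derivable Γ (φ.imp φ) := mp (gax (.a1 φ φ)) (gax (.a13 φ φ))

theorem imp_of (h : Derivable Γ φ) : Derivable Γ (ψ.imp φ) := mp h (gax (.a1 φ ψ))

theorem imp_mp (h₁ : Derivable Γ (ψ.imp φ)) (h₂ : Derivable Γ (ψ.imp (φ.imp χ))) :
    Derivable Γ (ψ.imp χ) :=
  mp (mp h₁ (mp (mp h₂ (gax (.a9 ψ φ χ))) (gax (.a8 _ _ _)))) (gax (.a13 ψ χ))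

theorem deduction (h : Derivable (insert ψ Γ) φ) : Derivable Γ (ψ.imp φ) := by
  generalize hΔ : insert ψ Γ = Δ at h
  induction h with
  | hyp h =>
    subst hΔ
    rcases h with rfl | h
    · exact imp_self
    · exact imp_of (hyp h)
  | ax h => exact imp_of (ax h)
  | mp _ _ ih₁ ih₂ => exact imp_mp (ih₁ hΔ) (ih₂ hΔ)
  | necBox h => exact imp_of (necBox h)
  | necDia h => exact imp_of (necDia h)

theorem imp_trans (h₁ : Derivable Γ (φ.imp ψ)) (h₂ : Derivable Γ (ψ.imp χ)) :
    Derivable Γ (φ.imp χ) := mp h₁ (mp h₂ (gax (.a8 _ _ _)))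

theorem and_intro (h₁ : Derivable Γ φ) (h₂ : Derivable Γ ψ) : Derivable Γ (φ.and ψ) :=
  mp h₂ (mp h₁ (gax (.a4 _ _)))

theorem and_left (h : Derivable Γ (φ.and ψ)) : Derivable Γ φ := mp h (gax (.a2 _ _))

theorem or_imp (h₁ : Derivable Γ (φ.imp χ)) (h₂ : Derivable Γ (ψ.imp χ)) :
    Derivable Γ ((φ.or ψ).imp χ) := mp (and_intro h₁ h₂) (gax (.a10 _ _ _))

theorem or_inl : Derivable Γ (φ.imp (φ.or ψ)) := gax (.a6 _ _)

theorem or_inr : Derivable Γ (ψ.imp (φ.or ψ)) := gax (.a7 _ _)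

theorem bot_imp : Derivable Γ (Formula.bot.imp φ) := and_left (gax (.a5 φ))

theorem top : Derivable Γ (Formula.top : Formula V) := imp_self

theorem exists_of_sUnion {c : Set (Set (Formula V))} (hc : IsChain (· ⊆ ·) c)
    (hne : c.Nonempty) (h : Derivable (⋃₀ c) φ) : ∃ s ∈ c, Derivable s φ := by
  generalize hΔ : ⋃₀ c = Δ at h
  obtain ⟨s₀, hs₀⟩ := hne
  induction h with
  | hyp h =>
    subst hΔ
    obtain ⟨s, hs, hφ⟩ := h
    exact ⟨s, hs, hyp hφ⟩
  | ax h => exact ⟨s₀, hs₀, ax h⟩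
  | mp _ _ ih₁ ih₂ =>
    obtain ⟨s, hs, h₁⟩ := ih₁ hΔ
    obtain ⟨t, ht, h₂⟩ := ih₂ hΔ
    rcases hc.total hs ht with hst | hst
    · exact ⟨t, ht, mp (h₁.mono hst) h₂⟩
    · exact ⟨s, hs, mp h₁ (h₂.mono hst)⟩
  | necBox h => exact ⟨s₀, hs₀, necBox h⟩
  | necDia h => exact ⟨s₀, hs₀, necDia h⟩

theorem box_mono (h : Derivable ∅ (φ.imp ψ)) : Derivable Γ (φ.box.imp ψ.box) :=
  mp (necBox h) (ax (.gk (.kBox _ _)))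

theorem box_and : Derivable Γ (φ.box.imp (ψ.box.imp (φ.and ψ).box)) :=
  imp_trans (box_mono (gax (.a4 _ _))) (ax (.gk (.kBox _ _)))

/-- The `◇`-form of `(K_□)`, obtained from `(FS1)` and `φ → ((φ → ψ) → ψ)`. -/
theorem box_imp_dia : Derivable Γ ((φ.imp ψ).box.imp (φ.dia.imp ψ.dia)) := by
  have h : Derivable (∅ : Set (Formula V)) (φ.imp ((φ.imp ψ).imp ψ)) :=
    deduction (deduction (mp (hyp (by simp)) (hyp (by simp) : Derivable _ (φ.imp ψ))))
  exact mp (imp_trans (necDia h) (ax (.gk (.fs1 _ _)))) (gax (.a9 _ _ _))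

end Derivable

open Derivable

/-- Deductively closed, consistent sets of formulas with the disjunction property. -/
structure IsPrimeTheory (T : Set (Formula V)) : Prop where
  closed : ∀ {φ}, Derivable T φ → φ ∈ T
  prime : ∀ {φ ψ}, φ.or ψ ∈ T → φ ∈ T ∨ ψ ∈ T
  bot_notMem : Formula.bot ∉ T

/-- The prime filter theorem: a set none of whose consequences lie in a set `I` closed under `∨` extends to a
prime theory disjoint from `I`. -/
theorem exists_isPrimeTheory {S I : Set (Formula V)} (hne : I.Nonempty)
    (hor : ∀ a ∈ I, ∀ b ∈ I, a.or b ∈ I) (hS : ∀ a ∈ I, ¬ Derivable S a) :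
    ∃ T, IsPrimeTheory T ∧ S ⊆ T ∧ Disjoint T I := by
  obtain ⟨T, hST, hT⟩ := zorn_subset_nonempty {T | ∀ a ∈ I, ¬ Derivable T a}
    (fun c hc hchain hcne => ⟨⋃₀ c, fun a ha h => by
      obtain ⟨s, hs, h⟩ := exists_of_sUnion hchain hcne h
      exact hc hs a ha h, fun s hs => Set.subset_sUnion_of_mem hs⟩) S hS
  have key : ∀ φ, φ ∉ T → ∃ a ∈ I, Derivable T (φ.imp a) := by
    intro φ hφ
    by_contra! h
    refine hφ (hT.le_of_ge (y := insert φ T) (fun a ha hd => h a ha hd.deduction)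
      (Set.subset_insert _ _) (Set.mem_insert _ _))
  have hclosed : ∀ {φ}, Derivable T φ → φ ∈ T := by
    intro φ hφ
    by_contra h
    obtain ⟨a, ha, hd⟩ := key φ h
    exact hT.prop a ha (mp hφ hd)
  refine ⟨T, ⟨hclosed, ?_, ?_⟩, hST, ?_⟩
  · intro φ ψ h
    by_contra! hn
    obtain ⟨a, ha, hda⟩ := key φ hn.1
    obtain ⟨b, hb, hdb⟩ := key ψ hn.2
    exact hT.prop _ (hor a ha b hb)
      (mp (hyp h) (or_imp (imp_trans hda or_inl) (imp_trans hdb or_inr)))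
  · intro h
    obtain ⟨a, ha⟩ := hne
    exact hT.prop a ha (mp (hyp h) bot_imp)
  · exact Set.disjoint_left.2 fun a haT haI => hT.prop a haI (hyp haT)

namespace IsPrimeTheory

variable {T : Set (Formula V)}

/-- By prelinearity, `φ → ψ ∈ T` is a total preorder on the countable set of formulas, so its
quotient chain embeds into `ℚ`. -/
theorem exists_rat [Countable V] (hT : IsPrimeTheory T) :
    ∃ e : Formula V → ℚ, (∀ φ ψ, e φ ≤ e ψ ↔ φ.imp ψ ∈ T) ∧
      e Formula.bot = 0 ∧ e Formula.top = 1 := by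
  classical
  have := countable_formula (V := V)
  let P : Preorder (Formula V) :=
    { le := fun φ ψ => φ.imp ψ ∈ T
      le_refl := fun φ => hT.closed imp_self
      le_trans := fun φ ψ χ h₁ h₂ => hT.closed (imp_trans (hyp h₁) (hyp h₂)) }
  have htot : Std.Total (α := Formula V) (· ≤ ·) :=
    ⟨fun φ ψ => hT.prime (hT.closed (gax (.a14 φ ψ)))⟩
  have : Countable (Antisymmetrization (Formula V) (· ≤ ·)) :=
    (Quotient.mk_surjective (s := AntisymmRel.setoid (Formula V) (· ≤ ·))).countable
  obtain ⟨g⟩ := Order.embedding_from_countable_to_dense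
    (Antisymmetrization (Formula V) (· ≤ ·)) ℚ
  let e₀ : Formula V → ℚ := fun φ => g (toAntisymmetrization (· ≤ ·) φ)
  have he₀ : ∀ φ ψ, e₀ φ ≤ e₀ ψ ↔ φ.imp ψ ∈ T := fun φ ψ => by
    simp only [e₀, OrderEmbedding.le_iff_le, toAntisymmetrization_le_toAntisymmetrization_iff]
    rfl
  have hlt : e₀ Formula.bot < e₀ Formula.top := by
    rw [← not_le, he₀]
    exact fun h => hT.bot_notMem (hT.closed (mp Derivable.top (hyp h)))
  have hpos := sub_pos.2 hlt
  refine ⟨fun φ => (e₀ φ - e₀ Formula.bot) / (e₀ Formula.top - e₀ Formula.bot), ?_, ?_, ?_⟩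
  · intro φ ψ
    rw [div_le_div_iff_of_pos_right hpos, sub_le_sub_iff_right, he₀]
  · simp
  · exact div_self hpos.ne'

end IsPrimeTheory

/-! ### A countably saturated chain -/

/-- The hyperrationals, used as a linear order in which every countable cut is filled. -/
abbrev HyperRat : Type := Filter.Germ (Filter.hyperfilter ℕ : Filter ℕ) ℚ

namespace HyperRat

theorem exists_between_seq (a b : ℕ → HyperRat) (h : ∀ m n, a m < b n) :
    ∃ x, ∀ n, a n < x ∧ x < b n := by
  classical
  choose a' ha using fun n => Quotient.exists_rep (a n)
  choose b' hb using fun n => Quotient.exists_rep (b n)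
  change ∀ n, ((a' n : ℕ → ℚ) : HyperRat) = a n at ha
  change ∀ n, ((b' n : ℕ → ℚ) : HyperRat) = b n at hb
  -- At index `i`, interpolate between as many of the first `i` representatives as are ordered.
  let P : ℕ → ℕ → Prop := fun i k => ∀ m < k, ∀ n < k, a' m i < b' n i
  let k : ℕ → ℕ := fun i => Nat.findGreatest (P i) i
  have hk : ∀ i, P i (k i) := fun i =>
    Nat.findGreatest_spec (P := P i) (Nat.zero_le i) (by simp [P])
  have hx : ∀ i, ∃ x : ℚ, ∀ m < k i, a' m i < x ∧ x < b' m i := by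
    intro i
    obtain ⟨x, h₁, h₂⟩ := Order.exists_between_finsets
      ((Finset.range (k i)).image (a' · i)) ((Finset.range (k i)).image (b' · i)) (by
        simp only [Finset.mem_image, Finset.mem_range]
        rintro _ ⟨m, hm, rfl⟩ _ ⟨n, hn, rfl⟩
        exact hk i m hm n hn)
    exact ⟨x, fun m hm => ⟨h₁ _ (Finset.mem_image_of_mem _ (Finset.mem_range.2 hm)),
      h₂ _ (Finset.mem_image_of_mem _ (Finset.mem_range.2 hm))⟩⟩
  choose x hx using hx
  have hP : ∀ k, ∀ᶠ i in (Filter.hyperfilter ℕ : Filter ℕ), P i k := fun k => by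
    refine (Filter.eventually_all_finite (Set.finite_lt_nat k)).2 fun m _ =>
      (Filter.eventually_all_finite (Set.finite_lt_nat k)).2 fun n _ => ?_
    have := h m n
    rw [← ha, ← hb] at this
    exact Filter.Germ.coe_lt.1 this
  have hlarge : ∀ n, ∀ᶠ i in (Filter.hyperfilter ℕ : Filter ℕ), n < k i := fun n => by
    have hge : ∀ᶠ i in (Filter.hyperfilter ℕ : Filter ℕ), n + 1 ≤ i := by
      refine Filter.hyperfilter_le_cofinite ?_
      rw [Nat.cofinite_eq_atTop]
      exact Filter.eventually_ge_atTop _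
    filter_upwards [hP (n + 1), hge] with i hi hni
    exact Nat.le_findGreatest hni hi
  refine ⟨((x : ℕ → ℚ) : HyperRat), fun n => ⟨?_, ?_⟩⟩
  · rw [← ha]
    exact Filter.Germ.coe_lt.2 ((hlarge n).mono fun i hi => (hx i n hi).1)
  · rw [← hb]
    exact Filter.Germ.coe_lt.2 ((hlarge n).mono fun i hi => (hx i n hi).2)

instance : DenselyOrdered HyperRat :=
  ⟨fun a b h => (exists_between_seq (fun _ => a) (fun _ => b) fun _ _ => h).imp fun _ hx => hx 0⟩

theorem exists_between_sets {A B : Set HyperRat} (hA : A.Countable) (hB : B.Countable)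
    (hAne : A.Nonempty) (hBne : B.Nonempty) (h : ∀ a ∈ A, ∀ b ∈ B, a < b) :
    ∃ x, (∀ a ∈ A, a < x) ∧ ∀ b ∈ B, x < b := by
  obtain ⟨a, rfl⟩ := hA.exists_eq_range hAne
  obtain ⟨b, rfl⟩ := hB.exists_eq_range hBne
  obtain ⟨x, hx⟩ := exists_between_seq a b fun m n => h _ ⟨m, rfl⟩ _ ⟨n, rfl⟩
  exact ⟨x, by rintro _ ⟨n, rfl⟩; exact (hx n).1, by rintro _ ⟨n, rfl⟩; exact (hx n).2⟩

theorem exists_gt_seq (a : ℕ → HyperRat) : ∃ y, ∀ n, a n < y := by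
  choose a' ha using fun n => Quotient.exists_rep (a n)
  change ∀ n, ((a' n : ℕ → ℚ) : HyperRat) = a n at ha
  choose y hy using fun i : ℕ => ((Finset.range (i + 1)).image (a' · i)).exists_le
  refine ⟨((fun i => y i + 1 : ℕ → ℚ) : HyperRat), fun n => ?_⟩
  rw [← ha]
  refine Filter.Germ.coe_lt.2 (Filter.hyperfilter_le_cofinite ?_)
  rw [Nat.cofinite_eq_atTop]
  filter_upwards [Filter.eventually_ge_atTop n] with i hi
  exact (hy i _ (Finset.mem_image_of_mem _ (Finset.mem_range.2 (by omega)))).trans_lt (lt_add_one _)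

theorem exists_strictMono_between {A B : Set HyperRat} (hA : A.Countable) (hB : B.Countable)
    (h : ∀ a ∈ A, ∀ b ∈ B, a < b) :
    ∃ g : ℚ → HyperRat, StrictMono g ∧ (∀ a ∈ A, ∀ q, a < g q) ∧ ∀ b ∈ B, ∀ q, g q < b := by
  -- Adjoining a common strict lower bound to `A` and a common strict upper bound to `B` makes both
  -- sets nonempty.
  have hAB : (A ∪ B ∪ {0}).Countable := (hA.union hB).union (Set.countable_singleton 0)
  obtain ⟨c, hc⟩ := hAB.exists_eq_range ⟨0, by simp⟩
  obtain ⟨y, hy⟩ := exists_gt_seq c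
  obtain ⟨x, hx⟩ := exists_gt_seq fun n => -c n
  have hy' : ∀ d ∈ A ∪ B ∪ {0}, d < y := by rw [hc]; rintro _ ⟨n, rfl⟩; exact hy n
  have hx' : ∀ d ∈ A ∪ B ∪ {0}, -x < d := by
    rw [hc]; rintro _ ⟨n, rfl⟩; exact neg_lt.1 (hx n)
  have hxy : -x < y := (hx' 0 (by simp)).trans (hy' 0 (by simp))
  obtain ⟨l, hl₁, hl₂⟩ := exists_between_sets (hA.insert (-x)) (hB.insert y)
    (Set.insert_nonempty _ _) (Set.insert_nonempty _ _) (by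
      rintro a (rfl | ha) b (rfl | hb)
      · exact hxy
      · exact hx' b (by simp [hb])
      · exact hy' a (by simp [ha])
      · exact h a ha b hb)
  obtain ⟨r, hr₁, hr₂⟩ := exists_between_sets (Set.countable_singleton l) (hB.insert y)
    (Set.singleton_nonempty _) (Set.insert_nonempty _ _) (by
      rintro _ rfl b hb
      exact hl₂ b hb)
  have hlr : l < r := hr₁ l rfl
  have : Nontrivial (Set.Ioo l r) := by
    obtain ⟨z, hz⟩ := exists_between hlr
    obtain ⟨w, hw⟩ := exists_between hz.1
    exact ⟨⟨z, hz⟩, ⟨w, hw.1, hw.2.trans hz.2⟩, fun h => hw.2.ne (congrArg Subtype.val h).symm⟩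
  obtain ⟨g⟩ := Order.embedding_from_countable_to_dense ℚ (Set.Ioo l r)
  exact ⟨fun q => g q, fun p q h => g.strictMono h,
    fun a ha q => (hl₁ a (.inr ha)).trans (g q).2.1,
    fun b hb q => (g q).2.2.trans (hr₂ b (.inr hb))⟩

/-- Amalgamation of a countable subset `C` of the hyperrationals with the chain `ℚ`, along
prescribed comparisons. `L c x` says that `c` is to lie at or below `x`, and `N x c` that `x` is to
lie at or below `c`. If both hold, then `x` is placed at `c`; if only one of them holds, the
comparison is strict; if neither holds, `x` is placed strictly below `c`. -/
theorem exists_placement {C : Set HyperRat} (hC : C.Countable) {L : HyperRat → ℚ → Prop}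
    {N : ℚ → HyperRat → Prop}
    (hL : ∀ {c c' x x'}, c ≤ c' → x ≤ x' → L c' x → L c x')
    (hN : ∀ {c c' x x'}, c ≤ c' → x ≤ x' → N x' c → N x c')
    (hLN : ∀ {c c' x}, L c x → N x c' → c ≤ c') (hNL : ∀ {c x y}, N x c → L c y → x ≤ y) :
    ∃ f : ℚ → HyperRat, StrictMono f ∧
      ∀ c ∈ C, ∀ x, (c ≤ f x ↔ L c x) ∧ (f x ≤ c ↔ N x c ∨ ¬ L c x) := by
  classical
  -- A rational that is not forced to equal an element of `C` goes into the gap of `C` above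
  -- `{c ∈ C | L c x}`, and each such gap receives an order embedding `G x` of `ℚ`, which depends
  -- only on the gap.
  have hgap : ∀ A : Set HyperRat, ∃ g : ℚ → HyperRat,
      (∀ a ∈ C ∩ A, ∀ b ∈ C \ A, a < b) → StrictMono g ∧ (∀ a ∈ C ∩ A, ∀ q, a < g q) ∧
        ∀ b ∈ C \ A, ∀ q, g q < b := by
    intro A
    by_cases h : ∀ a ∈ C ∩ A, ∀ b ∈ C \ A, a < b
    · obtain ⟨g, hg⟩ := exists_strictMono_between (hC.mono Set.inter_subset_left)
        (hC.mono Set.sdiff_subset) h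
      exact ⟨g, fun _ => hg⟩
    · exact ⟨fun _ => 0, fun h' => absurd h' h⟩
  choose G hG using hgap
  have hG' := fun x => hG {c | c ∈ C ∧ L c x} fun a ha b hb => by
    by_contra hle
    exact hb.2 ⟨hb.1, hL (not_lt.1 hle) le_rfl ha.2.2⟩
  have hcut : ∀ x, ∃ y, (y ∈ C ∧ L y x ∧ N x y) ∨
      ((∀ c ∈ C, ¬ (L c x ∧ N x c)) ∧ y = G {c | c ∈ C ∧ L c x} x) := by
    intro x
    by_cases h : ∃ c ∈ C, L c x ∧ N x c
    · obtain ⟨c, hc⟩ := h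
      exact ⟨c, .inl hc⟩
    · push Not at h
      exact ⟨_, .inr ⟨fun c hc h' => h c hc h'.1 h'.2, rfl⟩⟩
  choose f hf using hcut
  have hlow : ∀ x, ∀ c ∈ C, (∀ c ∈ C, ¬ (L c x ∧ N x c)) → f x = G {c | c ∈ C ∧ L c x} x →
      (L c x → c < f x) ∧ (¬ L c x → f x < c) := fun x c hc _ hx => by
    rw [hx]
    exact ⟨fun h => (hG' x).2.1 c ⟨hc, hc, h⟩ x, fun h => (hG' x).2.2 c ⟨hc, fun h' => h h'.2⟩ x⟩
  have hmain : ∀ c ∈ C, ∀ x, (c ≤ f x ↔ L c x) ∧ (f x ≤ c ↔ N x c ∨ ¬ L c x) := by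
    intro c hc x
    rcases hf x with ⟨_, h₁, h₂⟩ | ⟨hn, hx⟩
    · refine ⟨⟨fun h => hL h le_rfl h₁, fun h => hLN h h₂⟩, fun h => .inl (hN h le_rfl h₂), ?_⟩
      rintro (h | h)
      · exact hLN h₁ h
      · by_contra hle
        exact h (hL (not_le.1 hle).le le_rfl h₁)
    · have := hlow x c hc hn hx
      by_cases h : L c x
      · have hN' : ¬ N x c := fun h' => hn c hc ⟨h, h'⟩
        simp [h, hN', (this.1 h).le, this.1 h]
      · simp [h, (this.2 h).le, this.2 h]
  refine ⟨f, fun x y hxy => ?_, hmain⟩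
  rcases hf x with ⟨hc, h₁, h₂⟩ | ⟨hn, hx⟩
  · refine lt_of_le_of_ne ((hmain _ hc y).1.2 (hL le_rfl hxy.le h₁)) fun h => ?_
    rcases hf y with ⟨_, h₃, h₄⟩ | ⟨hn', hy⟩
    · exact absurd (hNL (h ▸ h₄) h₁) (not_le.2 hxy)
    · exact ((hlow y _ hc hn' hy).1 (hL le_rfl hxy.le h₁)).ne h
  · rcases hf y with ⟨hc, h₃, h₄⟩ | ⟨hn', hy⟩
    · exact (hlow x _ hc hn hx).2 fun h => absurd (hNL h₄ h) (not_le.2 hxy)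
    · by_cases h : ∃ c ∈ C, L c y ∧ ¬ L c x
      · obtain ⟨c, hc, h₁, h₂⟩ := h
        exact ((hlow x c hc hn hx).2 h₂).trans ((hlow y c hc hn' hy).1 h₁)
      · push Not at h
        have : {c | c ∈ C ∧ L c x} = {c | c ∈ C ∧ L c y} := by
          ext c
          exact ⟨fun hc => ⟨hc.1, hL le_rfl hxy.le hc.2⟩, fun hc => ⟨hc.1, h c hc.1 hc.2⟩⟩
        rw [hx, hy, this]
        exact (hG' y).1 hxy

end HyperRat

/-! ### Countable dense chains in the unit interval -/

/-- A countable dense chain with end points embeds into `[0,1]` with dense image; such an embedding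
preserves all existing infima and suprema. -/
theorem exists_dense_embedding {Q : Type*} [LinearOrder Q] {D : Set Q} (hD : D.Countable)
    {a b : Q} (hab : a < b) (ha : a ∈ D) (hb : b ∈ D) (hbd : ∀ d ∈ D, a ≤ d ∧ d ≤ b)
    (hdense : ∀ x ∈ D, ∀ y ∈ D, x < y → ∃ z ∈ D, x < z ∧ z < y) :
    ∃ ι : Q → unitInterval, StrictMonoOn ι D ∧ ι a = 0 ∧ ι b = 1 ∧
      ∀ x y : unitInterval, x < y → ∃ d ∈ D, x < ι d ∧ ι d < y := by
  classical
  let I : Set Q := {d | d ∈ D ∧ a < d ∧ d < b}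
  have hI : I.Countable := hD.mono fun d hd => hd.1
  have hmid : ∀ x ∈ D, ∀ y ∈ D, x < y → ∃ z ∈ I, x < z ∧ z < y := fun x hx y hy h => by
    obtain ⟨z, hz, h₁, h₂⟩ := hdense x hx y hy h
    exact ⟨z, ⟨hz, (hbd x hx).1.trans_lt h₁, h₂.trans_le (hbd y hy).2⟩, h₁, h₂⟩
  have : Countable I := hI.to_subtype
  have : Nonempty I := by
    obtain ⟨z, hz, _⟩ := hmid a ha b hb hab
    exact ⟨⟨z, hz⟩⟩
  have : DenselyOrdered I := ⟨fun x y h => by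
    obtain ⟨z, hz, h₁, h₂⟩ := hmid x x.2.1 y y.2.1 h
    exact ⟨⟨z, hz⟩, h₁, h₂⟩⟩
  have : NoMinOrder I := ⟨fun x => by
    obtain ⟨z, hz, _, h₂⟩ := hmid a ha x x.2.1 x.2.2.1
    exact ⟨⟨z, hz⟩, h₂⟩⟩
  have : NoMaxOrder I := ⟨fun x => by
    obtain ⟨z, hz, h₁, _⟩ := hmid x x.2.1 b hb x.2.2.2
    exact ⟨⟨z, hz⟩, h₁⟩⟩
  have : Nonempty (Set.Ioo (0 : ℚ) 1) := ⟨⟨1 / 2, by norm_num⟩⟩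
  obtain ⟨g⟩ := Order.iso_of_countable_dense I (Set.Ioo (0 : ℚ) 1)
  have hg : ∀ d, (0 : ℝ) < ((g d : ℚ) : ℝ) ∧ ((g d : ℚ) : ℝ) < 1 := fun d => by
    exact_mod_cast (g d).2
  let ι : Q → unitInterval := fun d =>
    if h : d ∈ I then ⟨((g ⟨d, h⟩ : ℚ) : ℝ), (hg _).1.le, (hg _).2.le⟩ else if d ≤ a then 0 else 1
  have hι : ∀ d (h : d ∈ I), ι d = ⟨((g ⟨d, h⟩ : ℚ) : ℝ), (hg _).1.le, (hg _).2.le⟩ :=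
    fun d h => dif_pos h
  have hιa : ι a = 0 := by
    simp [ι, I]
  have hιb : ι b = 1 := by
    simp [ι, I, hab]
  refine ⟨ι, ?_, hιa, hιb, ?_⟩
  · have hcases : ∀ d ∈ D, d = a ∨ d = b ∨ d ∈ I := fun d hd => by
      by_cases h₁ : d = a
      · exact .inl h₁
      by_cases h₂ : d = b
      · exact .inr (.inl h₂)
      exact .inr (.inr ⟨hd, lt_of_le_of_ne (hbd d hd).1 (Ne.symm h₁),
        lt_of_le_of_ne (hbd d hd).2 h₂⟩)
    intro x hx y hy hxy
    rcases hcases x hx with rfl | rfl | hxI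
    · rcases hcases y hy with rfl | rfl | hyI
      · exact absurd hxy (lt_irrefl _)
      · rw [hιa, hιb]; exact zero_lt_one
      · rw [hιa, hι y hyI, ← Subtype.coe_lt_coe]; exact (hg _).1
    · exact absurd hxy (not_lt.2 (hbd y hy).2)
    · rcases hcases y hy with rfl | rfl | hyI
      · exact absurd hxy (not_lt.2 (hbd x hx).1)
      · rw [hιb, hι x hxI, ← Subtype.coe_lt_coe]; exact (hg _).2
      · rw [hι x hxI, hι y hyI]
        change ((g ⟨x, hxI⟩ : ℚ) : ℝ) < ((g ⟨y, hyI⟩ : ℚ) : ℝ)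
        exact Rat.cast_lt.2 (Subtype.coe_lt_coe.2 (g.strictMono hxy))
  · intro x y hxy
    obtain ⟨q, h₁, h₂⟩ := exists_rat_btwn (Subtype.coe_lt_coe.2 hxy)
    have hq : q ∈ Set.Ioo (0 : ℚ) 1 :=
      ⟨by exact_mod_cast x.2.1.trans_lt h₁, by exact_mod_cast h₂.trans_le y.2.2⟩
    refine ⟨g.symm ⟨q, hq⟩, (g.symm ⟨q, hq⟩).2.1, ?_⟩
    rw [hι _ (g.symm ⟨q, hq⟩).2]
    simp only [Subtype.coe_eta, OrderIso.apply_symm_apply]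
    exact ⟨h₁, h₂⟩

/-- A countable set is contained in a countable set closed under a countably-valued binary
operation. -/
theorem exists_countable_closure {X : Type*} (F : X → X → Set X) (hF : ∀ x y, (F x y).Countable)
    {s : Set X} (hs : s.Countable) :
    ∃ t, s ⊆ t ∧ t.Countable ∧ ∀ x ∈ t, ∀ y ∈ t, F x y ⊆ t := by
  let G : Set X → Set X := fun t => t ∪ ⋃ x ∈ t, ⋃ y ∈ t, F x y
  let S : ℕ → Set X := fun n => G^[n] s
  have hS : ∀ n, S (n + 1) = G (S n) := fun n => Function.iterate_succ_apply' G n s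
  have hmono : Monotone S := monotone_nat_of_le_succ fun n => by
    rw [hS]; exact Set.subset_union_left
  refine ⟨⋃ n, S n, Set.subset_iUnion S 0, Set.countable_iUnion fun n => ?_, ?_⟩
  · induction n with
    | zero => exact hs
    | succ n ih =>
      rw [hS]
      exact ih.union (ih.biUnion fun x _ => ih.biUnion fun y _ => hF x y)
  · intro x hx y hy z hz
    obtain ⟨m, hm⟩ := Set.mem_iUnion.1 hx
    obtain ⟨n, hn⟩ := Set.mem_iUnion.1 hy
    refine Set.mem_iUnion.2 ⟨max m n + 1, ?_⟩
    rw [hS]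
    exact .inr (Set.mem_biUnion (hmono (le_max_left m n) hm)
      (Set.mem_biUnion (hmono (le_max_right m n) hn) hz))

/-! ### Hyperrational valuations and the canonical accessibility relation -/

/-- The worlds of the canonical model: homomorphisms from the formula algebra to the Gödel chain
`[0,1]` of the hyperrationals that send all theorems to `1`. -/
structure IsWorld (v : Formula V → HyperRat) : Prop where
  bot : v Formula.bot = 0
  and : ∀ a b, v (a.and b) = v a ⊓ v b
  or : ∀ a b, v (a.or b) = v a ⊔ v b
  imp : ∀ a b, v (a.imp b) = if v a ≤ v b then 1 else v b
  le_one : ∀ a, v a ≤ 1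
  thm : ∀ {a}, Derivable ∅ a → v a = 1

/-- The canonical accessibility relation: `w` is a candidate for a world seen from `v` as far as the
values of boxed and diamond formulas at `v` allow. -/
def Accessible (v w : Formula V → HyperRat) : Prop := ∀ a, v a.box ≤ w a ∧ w a ≤ v a.dia

namespace IsWorld

variable {v : Formula V → HyperRat}

theorem imp_eq_one (hv : IsWorld v) {a b : Formula V} : v (a.imp b) = 1 ↔ v a ≤ v b := by
  rw [hv.imp]
  split_ifs with h
  · simp [h]
  · exact ⟨fun h' => h' ▸ hv.le_one a, fun h' => absurd h' h⟩

theorem le_of_derivable (hv : IsWorld v) {a b : Formula V} (h : Derivable ∅ (a.imp b)) :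
    v a ≤ v b := hv.imp_eq_one.1 (hv.thm h)

theorem nonneg (hv : IsWorld v) (a : Formula V) : 0 ≤ v a :=
  hv.bot ▸ hv.le_of_derivable bot_imp

theorem le_imp_iff (hv : IsWorld v) {a b c : Formula V} :
    v c ≤ v (a.imp b) ↔ v c ⊓ v a ≤ v b := by
  rw [hv.imp]
  split_ifs with h
  · simp [hv.le_one, inf_le_of_right_le h]
  · simp [h]

theorem box_top (hv : IsWorld v) : v (Formula.top : Formula V).box = 1 :=
  hv.thm (necBox Derivable.top)

theorem dia_bot (hv : IsWorld v) : v (Formula.bot : Formula V).dia = 0 :=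
  le_antisymm (hv.bot ▸ hv.le_of_derivable (ax (.gk .fDia))) (hv.nonneg _)

theorem box_imp (hv : IsWorld v) {a b : Formula V} (h : v (a.imp b).box = 1) :
    v a.box ≤ v b.box := by
  have := hv.le_of_derivable (ax (.gk (.kBox a b)))
  rw [h] at this
  exact hv.imp_eq_one.1 (le_antisymm (hv.le_one _) this)

theorem dia_imp (hv : IsWorld v) {a b : Formula V} (h : v (a.imp b).box = 1) :
    v a.dia ≤ v b.dia := by
  have := hv.le_of_derivable (box_imp_dia (φ := a) (ψ := b))
  rw [h] at this
  exact hv.imp_eq_one.1 (le_antisymm (hv.le_one _) this)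

theorem box_and (hv : IsWorld v) (a b : Formula V) : v a.box ⊓ v b.box ≤ v (a.and b).box :=
  hv.le_imp_iff.1 (hv.le_of_derivable Derivable.box_and)

theorem dia_or (hv : IsWorld v) (a b : Formula V) : v (a.or b).dia ≤ v a.dia ⊔ v b.dia := by
  rw [← hv.or]
  exact hv.le_of_derivable (ax (.gk (.kDia a b)))

theorem box_or (hv : IsWorld v) (a b : Formula V) : v (a.or b).box ≤ v a.box ⊔ v b.dia := by
  rw [← hv.or]
  exact hv.le_of_derivable (ax (.cr a b))

theorem box_eq_one_of_derivable (hv : IsWorld v) {a : Formula V}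
    (h : Derivable {b : Formula V | v b.box = 1} a) : v a.box = 1 := by
  generalize hΓ : {b : Formula V | v b.box = 1} = Γ at h
  induction h with
  | hyp h => subst hΓ; exact h
  | ax h => exact hv.thm (necBox (ax h))
  | mp _ _ ih₁ ih₂ =>
    exact le_antisymm (hv.le_one _) ((ih₁ hΓ) ▸ hv.box_imp (ih₂ hΓ))
  | necBox h => exact hv.thm (necBox (necBox h))
  | necDia h => exact hv.thm (necBox (necDia h))

/-- The point where `(Cr)` is used. If the members of an upward directed family `K` have `□`-value
below `1`, then some prime theory contains the formulas of `□`-value `1` and avoids `K` as well as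
the formulas of `◇`-value below `1`. -/
theorem exists_isPrimeTheory (hv : IsWorld v) {K : Set (Formula V)} (hne : K.Nonempty)
    (hor : ∀ a ∈ K, ∀ b ∈ K, ∃ c ∈ K, Derivable ∅ ((a.or b).imp c))
    (hK : ∀ a ∈ K, v a.box < 1) :
    ∃ T, IsPrimeTheory T ∧ (∀ a, v a.box = 1 → a ∈ T) ∧ (∀ a, v a.dia < 1 → a ∉ T) ∧
      ∀ a ∈ K, a ∉ T := by
  have hbot : v (Formula.bot : Formula V).dia < 1 := by rw [hv.dia_bot]; exact zero_lt_one
  let I : Set (Formula V) :=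
    {a | ∃ c ∈ K, ∃ b : Formula V, v b.dia < 1 ∧ Derivable ∅ (a.imp (c.or b))}
  obtain ⟨c₀, hc₀⟩ := hne
  have hI : I.Nonempty := ⟨c₀, c₀, hc₀, _, hbot, or_inl⟩
  have hIor : ∀ a ∈ I, ∀ b ∈ I, a.or b ∈ I := by
    rintro a₁ ⟨c₁, hc₁, b₁, hb₁, h₁⟩ a₂ ⟨c₂, hc₂, b₂, hb₂, h₂⟩
    obtain ⟨c, hc, h⟩ := hor c₁ hc₁ c₂ hc₂
    refine ⟨c, hc, b₁.or b₂, (hv.dia_or _ _).trans_lt (max_lt hb₁ hb₂), or_imp ?_ ?_⟩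
    · exact imp_trans h₁ (or_imp (imp_trans (imp_trans or_inl h.weaken) or_inl)
        (imp_trans or_inl or_inr))
    · exact imp_trans h₂ (or_imp (imp_trans (imp_trans or_inr h.weaken) or_inl)
        (imp_trans or_inr or_inr))
  have hSI : ∀ a ∈ I, ¬ Derivable {b : Formula V | v b.box = 1} a := by
    rintro a ⟨c, hc, b, hb, h⟩ ha
    have h₁ := hv.box_eq_one_of_derivable (mp ha h.weaken)
    have h₂ := hv.box_or c b
    rw [h₁] at h₂
    exact absurd h₂ (not_le.2 (max_lt (hK c hc) hb))
  obtain ⟨T, hT, hST, hTI⟩ := GodelModal.exists_isPrimeTheory hI hIor hSI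
  exact ⟨T, hT, fun a ha => hST ha,
    fun a ha haT => Set.disjoint_left.1 hTI haT ⟨c₀, hc₀, a, ha, or_inr⟩,
    fun a ha haT => Set.disjoint_left.1 hTI haT ⟨a, ha, _, hbot, or_inl⟩⟩

end IsWorld

/-- A map that orders formulas as a prime theory does is a world. For the Gödel clause of the
implication, prelinearity and contraction put `(a → b) → a`, hence `(a → b) → b`, into `T` whenever
`a → b ∉ T`. -/
theorem IsPrimeTheory.isWorld {T : Set (Formula V)} (hT : IsPrimeTheory T)
    {w : Formula V → HyperRat} (hw : ∀ a b, w a ≤ w b ↔ a.imp b ∈ T)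
    (hbot : w Formula.bot = 0) (htop : w Formula.top = 1) : IsWorld w := by
  have hle : ∀ a, w a ≤ 1 := fun a => by
    rw [← htop, hw]
    exact hT.closed (imp_of Derivable.top)
  have hone : ∀ {a}, a ∈ T → w a = 1 := fun {a} ha => by
    refine le_antisymm (hle a) ?_
    rw [← htop, hw]
    exact hT.closed (imp_of (hyp ha))
  refine ⟨hbot, fun a b => ?_, fun a b => ?_, fun a b => ?_, hle,
    fun h => hone (hT.closed h.weaken)⟩
  · refine le_antisymm (le_inf ((hw _ _).2 (hT.closed (gax (.a2 _ _))))
      ((hw _ _).2 (hT.closed (gax (.a3 _ _))))) ?_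
    rcases le_total (w a) (w b) with h | h
    · rw [inf_eq_left.2 h, hw]
      exact hT.closed (mp (and_intro imp_self (hyp ((hw _ _).1 h))) (gax (.a12 _ _ _)))
    · rw [inf_eq_right.2 h, hw]
      exact hT.closed (mp (and_intro (hyp ((hw _ _).1 h)) imp_self) (gax (.a12 _ _ _)))
  · refine le_antisymm ?_ (sup_le ((hw _ _).2 (hT.closed or_inl)) ((hw _ _).2 (hT.closed or_inr)))
    rcases le_total (w a) (w b) with h | h
    · rw [sup_eq_right.2 h, hw]
      exact hT.closed (or_imp (hyp ((hw _ _).1 h)) imp_self)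
    · rw [sup_eq_left.2 h, hw]
      exact hT.closed (or_imp imp_self (hyp ((hw _ _).1 h)))
  · split_ifs with h
    · exact hone ((hw _ _).1 h)
    · refine le_antisymm ?_ ((hw _ _).2 (hT.closed (gax (.a1 _ _))))
      have hn : a.imp b ∉ T := fun h' => h ((hw _ _).2 h')
      have h₁ : (a.imp b).imp a ∈ T := by
        refine (hT.prime (hT.closed (gax (.a14 a (a.imp b))))).resolve_left fun h' => hn ?_
        exact hT.closed (mp (hyp h') (gax (.a13 _ _)))
      exact (hw _ _).2 (hT.closed (imp_mp (hyp h₁) imp_self))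

theorem exists_isWorld_of_not_derivable [Countable V] {Γ : Set (Formula V)} {φ : Formula V}
    (h : ¬ Derivable Γ φ) : ∃ v, IsWorld v ∧ (∀ γ ∈ Γ, v γ = 1) ∧ v φ < 1 := by
  obtain ⟨T, hT, hΓ, hφ⟩ := exists_isPrimeTheory (S := Γ) (I := {a | Derivable ∅ (a.imp φ)})
    ⟨φ, imp_self⟩ (fun a ha b hb => or_imp ha hb) fun a ha hd => h (mp hd ha.weaken)
  obtain ⟨e, he, hbot, htop⟩ := hT.exists_rat
  have hw : ∀ a b, (((e a : ℚ) : HyperRat) ≤ ((e b : ℚ) : HyperRat)) ↔ a.imp b ∈ T := fun a b => by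
    rw [← he]; exact Rat.cast_le
  have hworld := hT.isWorld (w := fun a => ((e a : ℚ) : HyperRat)) hw
    (by simp [hbot]) (by simp [htop])
  refine ⟨_, hworld, fun γ hγ => ?_, ?_⟩
  · refine le_antisymm (hworld.le_one _) ?_
    rw [← hworld.thm Derivable.top]
    exact (hw _ _).2 (hT.closed (imp_of (hyp (hΓ hγ))))
  · rw [← hworld.thm Derivable.top]
    refine not_le.1 fun hle => Set.disjoint_left.1 hφ ?_ (imp_self : Derivable ∅ (φ.imp φ))
    exact hT.closed (mp Derivable.top (hyp ((hw _ _).1 hle)))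

namespace IsWorld

variable {v : Formula V → HyperRat}

/-- Amalgamation of the chain of values of `v` with the chain of formulas ordered by `T` yields an
accessible world. Where the accessibility bounds leave the position of a formula relative to a value
open, the formula goes below the value if `low` holds, and above it otherwise; this is recorded for
the extra value `d`, which need not be a value of `v`. -/
theorem exists_accessible (hv : IsWorld v) [Countable V] {T : Set (Formula V)}
    (hT : IsPrimeTheory T) (hbox : ∀ a, v a.box = 1 → a ∈ T) (hdia : ∀ a, v a.dia < 1 → a ∉ T)
    (d : HyperRat) (low : Prop) :
    ∃ w, IsWorld w ∧ Accessible v w ∧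
      (∀ a, low → (∀ b : Formula V, d ≤ v b.box → b.imp a ∉ T) → w a < d) ∧
      (∀ a, ¬ low → (∀ b : Formula V, v b.dia ≤ d → a.imp b ∉ T) → d < w a) := by
  have := countable_formula (V := V)
  obtain ⟨e, he, -, -⟩ := hT.exists_rat
  let P : HyperRat → ℚ → Prop := fun c x => ∃ b, c ≤ v b.box ∧ e b ≤ x
  let N : ℚ → HyperRat → Prop := fun x c => ∃ b, x ≤ e b ∧ v b.dia ≤ c
  have hP : ∀ {c c' x x'}, c ≤ c' → x ≤ x' → P c' x → P c x' := fun hc hx ⟨b, h₁, h₂⟩ =>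
    ⟨b, hc.trans h₁, h₂.trans hx⟩
  have hN : ∀ {c c' x x'}, c ≤ c' → x ≤ x' → N x' c → N x c' := fun hc hx ⟨b, h₁, h₂⟩ =>
    ⟨b, hx.trans h₁, h₂.trans hc⟩
  -- `(FS1)` shows that the forced comparisons are consistent with the order of the values of `v`,
  -- and `(FS2)` that they are consistent with `T`.
  have hPN : ∀ {c c' x}, P c x → N x c' → c ≤ c' := by
    rintro c c' x ⟨a, h₁, h₂⟩ ⟨b, h₃, h₄⟩
    have hab : v (a.imp b).dia = 1 := by
      by_contra hne
      exact hdia _ (lt_of_le_of_ne (hv.le_one _) hne) ((he _ _).1 (h₂.trans h₃))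
    have := hv.le_of_derivable (ax (.gk (.fs1 a b)))
    rw [hab] at this
    exact h₁.trans ((hv.imp_eq_one.1 (le_antisymm (hv.le_one _) this)).trans h₄)
  have hNP : ∀ {c x y}, N x c → P c y → x ≤ y := by
    rintro c x y ⟨a, h₁, h₂⟩ ⟨b, h₃, h₄⟩
    have := hv.le_of_derivable (ax (.gk (.fs2 a b)))
    rw [hv.imp_eq_one.2 (h₂.trans h₃)] at this
    exact h₁.trans (((he _ _).2 (hbox _ (le_antisymm (hv.le_one _) this))).trans h₄)
  let C : Set HyperRat := Set.range v ∪ {d}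
  have hC : C.Countable := (Set.countable_range v).union (Set.countable_singleton d)
  let L : HyperRat → ℚ → Prop := fun c x => P c x ∨ (¬ low ∧ ¬ N x c)
  have hcN : ∀ {c c' x}, ¬ N x c → N x c' → c ≤ c' := fun h h' => by
    by_contra hlt
    exact h (hN (not_le.1 hlt).le le_rfl h')
  have hNc : ∀ {c x y}, N x c → ¬ N y c → x ≤ y := fun h h' => by
    by_contra hlt
    exact h' (hN le_rfl (not_le.1 hlt).le h)
  obtain ⟨f, hf, hfC⟩ := HyperRat.exists_placement hC (L := L) (N := N)
    (fun hc hx h => h.imp (hP hc hx) (And.imp_right (mt (hN hc hx)))) hN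
    (fun h h' => h.elim (hPN · h') fun h => hcN h.2 h')
    (fun h h' => h'.elim (hNP h) fun h' => hNc h h'.2)
  have hmem : ∀ a, v a ∈ C := fun a => .inl ⟨a, rfl⟩
  have hacc : Accessible v fun a => f (e a) := fun a =>
    ⟨(hfC _ (hmem _) _).1.2 (.inl ⟨a, le_rfl, le_rfl⟩),
      (hfC _ (hmem _) _).2.2 (.inl ⟨a, le_rfl, le_rfl⟩)⟩
  refine ⟨fun a => f (e a), hT.isWorld (fun a b => by rw [hf.le_iff_le, he]) ?_ ?_, hacc, ?_, ?_⟩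
  · exact le_antisymm ((hacc _).2.trans hv.dia_bot.le) ((hv.nonneg _).trans (hacc _).1)
  · refine le_antisymm ?_ (hv.box_top.ge.trans (hacc _).1)
    have h1 : (1 : HyperRat) = v Formula.top := (hv.thm Derivable.top).symm
    rw [h1]
    exact (hfC _ (hmem _) _).2.2 (.inl ⟨Formula.top, le_rfl, h1 ▸ hv.le_one _⟩)
  · intro a hlow h
    refine not_le.1 fun hle => ?_
    rcases (hfC d (.inr rfl) _).1.1 hle with ⟨b, h₁, h₂⟩ | h'
    · exact h b h₁ ((he _ _).1 h₂)
    · exact h'.1 hlow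
  · intro a hlow h
    have hNa : ¬ N (e a) d := fun ⟨b, h₁, h₂⟩ => h b h₂ ((he _ _).1 h₁)
    refine not_le.1 fun hle => ?_
    rcases (hfC d (.inr rfl) _).2.1 hle with h' | h'
    · exact hNa h'
    · exact h' (.inr ⟨hlow, hNa⟩)

/-- Accessible worlds bring the value of `φ` below anything above `v (□φ)`. Formulas `b → φ` with
`v (□φ) < v (□b)` are kept out of the prime theory, so nothing forces `φ` above `d`. -/
theorem exists_accessible_lt (hv : IsWorld v) [Countable V] {φ : Formula V} {d : HyperRat}
    (hd : v φ.box < d) (hd1 : d ≤ 1) : ∃ w, IsWorld w ∧ Accessible v w ∧ w φ < d := by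
  obtain ⟨T, hT, hbox, hdia, hK⟩ := hv.exists_isPrimeTheory
    (K := {a | ∃ b, v φ.box < v b.box ∧ a = b.imp φ}) ⟨_, Formula.top, by
      rw [hv.box_top]; exact hd.trans_le hd1, rfl⟩ (by
      rintro _ ⟨a, ha, rfl⟩ _ ⟨b, hb, rfl⟩
      exact ⟨_, ⟨a.and b, (lt_inf_iff.2 ⟨ha, hb⟩).trans_le (hv.box_and a b), rfl⟩,
        or_imp (deduction (imp_trans (gax (.a2 _ _)) (hyp (by simp))))
          (deduction (imp_trans (gax (.a3 _ _)) (hyp (by simp))))⟩) (by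
      rintro _ ⟨a, ha, rfl⟩
      exact lt_of_le_of_ne (hv.le_one _) fun h => absurd (hv.box_imp h) (not_le.2 ha))
  obtain ⟨w, hw, hvw, hlt, -⟩ := hv.exists_accessible hT hbox hdia d True
  exact ⟨w, hw, hvw, hlt φ trivial fun b hb => hK _ ⟨b, hd.trans_le hb, rfl⟩⟩

/-- The dual statement for `◇`, with the formulas `φ → b` for `v (◇b) < v (◇φ)` kept out of the
prime theory. -/
theorem exists_accessible_gt (hv : IsWorld v) [Countable V] {φ : Formula V} {d : HyperRat}
    (hd : d < v φ.dia) (hd0 : 0 ≤ d) : ∃ w, IsWorld w ∧ Accessible v w ∧ d < w φ := by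
  obtain ⟨T, hT, hbox, hdia, hK⟩ := hv.exists_isPrimeTheory
    (K := {a | ∃ b, v b.dia < v φ.dia ∧ a = φ.imp b}) ⟨_, Formula.bot, by
      rw [hv.dia_bot]; exact hd0.trans_lt hd, rfl⟩ (by
      rintro _ ⟨a, ha, rfl⟩ _ ⟨b, hb, rfl⟩
      exact ⟨_, ⟨a.or b, (hv.dia_or a b).trans_lt (max_lt ha hb), rfl⟩,
        or_imp (deduction (imp_trans (hyp (by simp)) or_inl))
          (deduction (imp_trans (hyp (by simp)) or_inr))⟩) (by
      rintro _ ⟨a, ha, rfl⟩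
      exact lt_of_le_of_ne (hv.le_one _) fun h => absurd (hv.dia_imp h) (not_le.2 ha))
  obtain ⟨w, hw, hvw, -, hgt⟩ := hv.exists_accessible hT hbox hdia d False
  exact ⟨w, hw, hvw, hgt φ id fun b hb => hK _ ⟨b, hb.trans_lt hd, rfl⟩⟩

end IsWorld

/-! ### Soundness -/

section Soundness

variable {W : Type v} {M : Model V W}

theorem le_gimp_iff {a b c : unitInterval} : c ≤ gimp a b ↔ c ⊓ a ≤ b := by
  unfold gimp
  split_ifs with h
  · simp [unitInterval.le_one', inf_le_of_right_le h]
  · simp [h]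

theorem gimp_eq_one {a b : unitInterval} : gimp a b = 1 ↔ a ≤ b := by
  have := le_gimp_iff (a := a) (b := b) (c := 1)
  rw [inf_eq_right.2 unitInterval.le_one'] at this
  rw [← this]
  exact ⟨fun h => h.ge, fun h => le_antisymm unitInterval.le_one' h⟩

theorem gimp_inf_le (a b : unitInterval) : gimp a b ⊓ a ≤ b := le_gimp_iff.1 le_rfl

theorem one_gimp (a : unitInterval) : gimp 1 a = a :=
  le_antisymm (by simpa [inf_eq_left.2 unitInterval.le_one'] using gimp_inf_le 1 a)
    (le_gimp_iff.2 inf_le_left)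

theorem zero_gimp (a : unitInterval) : gimp 0 a = 1 := gimp_eq_one.2 unitInterval.nonneg'

namespace Model

theorem eval_top (w : W) : M.eval w Formula.top = 1 := gimp_eq_one.2 le_rfl

theorem eval_gaxiom {φ : Formula V} (h : GAxiom φ) (w : W) : M.eval w φ = 1 := by
  cases h with
  | a1 φ ψ => simp only [eval, gimp_eq_one, le_gimp_iff]; exact inf_le_left
  | a2 φ ψ => simp only [eval, gimp_eq_one]; exact inf_le_left
  | a3 φ ψ => simp only [eval, gimp_eq_one]; exact inf_le_right
  | a4 φ ψ => simp only [eval, gimp_eq_one, le_gimp_iff]; exact le_rfl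
  | a5 φ =>
    change gimp 0 (M.eval w φ) ⊓ gimp (M.eval w φ) (M.eval w Formula.top) = 1
    rw [zero_gimp, eval_top, gimp_eq_one.2 unitInterval.le_one', inf_idem]
  | a6 φ ψ => simp only [eval, gimp_eq_one]; exact le_sup_left
  | a7 φ ψ => simp only [eval, gimp_eq_one]; exact le_sup_right
  | a8 φ ψ χ =>
    simp only [eval, gimp_eq_one, le_gimp_iff]
    exact (le_inf (inf_le_left.trans inf_le_left)
      ((inf_le_inf_right _ inf_le_right).trans (gimp_inf_le _ _))).trans (gimp_inf_le _ _)
  | a9 φ ψ χ =>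
    simp only [eval, gimp_eq_one, le_gimp_iff]
    rw [inf_right_comm]
    exact (inf_le_inf_right _ (gimp_inf_le _ _)).trans (gimp_inf_le _ _)
  | a10 φ ψ χ =>
    simp only [eval, gimp_eq_one, le_gimp_iff]
    rw [inf_sup_left]
    exact sup_le ((inf_le_inf_right _ inf_le_left).trans (gimp_inf_le _ _))
      ((inf_le_inf_right _ inf_le_right).trans (gimp_inf_le _ _))
  | a11 φ ψ χ =>
    simp only [eval, gimp_eq_one, le_gimp_iff]
    rw [← inf_assoc]
    exact (inf_le_inf_right _ (gimp_inf_le _ _)).trans (gimp_inf_le _ _)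
  | a12 φ ψ χ =>
    simp only [eval, gimp_eq_one, le_gimp_iff]
    exact le_inf ((inf_le_inf_right _ inf_le_left).trans (gimp_inf_le _ _))
      ((inf_le_inf_right _ inf_le_right).trans (gimp_inf_le _ _))
  | a13 φ ψ =>
    simp only [eval, gimp_eq_one, le_gimp_iff]
    exact (le_inf (gimp_inf_le _ _) inf_le_right).trans (gimp_inf_le _ _)
  | a14 φ ψ =>
    simp only [eval]
    rcases le_total (M.eval w φ) (M.eval w ψ) with h | h
    · rw [gimp_eq_one.2 h, sup_eq_left.2 unitInterval.le_one']
    · rw [gimp_eq_one.2 h, sup_eq_right.2 unitInterval.le_one']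

theorem le_eval_box (hM : M.IsCrisp) {w : W} {φ : Formula V} {c : unitInterval} :
    c ≤ M.eval w φ.box ↔ ∀ w', M.R w w' = 1 → c ≤ M.eval w' φ := by
  simp only [eval, le_iInf_iff]
  refine forall_congr' fun w' => ?_
  rcases hM w w' with h | h
  · simp [h, zero_gimp, unitInterval.le_one']
  · simp [h, one_gimp]

theorem eval_dia_le (hM : M.IsCrisp) {w : W} {φ : Formula V} {c : unitInterval} :
    M.eval w φ.dia ≤ c ↔ ∀ w', M.R w w' = 1 → M.eval w' φ ≤ c := by
  simp only [eval, iSup_le_iff]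
  refine forall_congr' fun w' => ?_
  rcases hM w w' with h | h
  · simp [h]
  · simp [h, inf_eq_right.2 (unitInterval.le_one' : M.eval w' φ ≤ 1)]

theorem eval_box_le (hM : M.IsCrisp) {w w' : W} {φ : Formula V} (h : M.R w w' = 1) :
    M.eval w φ.box ≤ M.eval w' φ := (le_eval_box hM).1 le_rfl _ h

theorem le_eval_dia (hM : M.IsCrisp) {w w' : W} {φ : Formula V} (h : M.R w w' = 1) :
    M.eval w' φ ≤ M.eval w φ.dia := (eval_dia_le hM).1 le_rfl _ h

theorem eval_gkaxiom (hM : M.IsCrisp) {φ : Formula V} (h : GKAxiom φ) (w : W) :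
    M.eval w φ = 1 := by
  cases h with
  | prop h => exact eval_gaxiom h w
  | kBox φ ψ =>
    rw [eval, gimp_eq_one, eval, le_gimp_iff, le_eval_box hM]
    intro w' hw
    exact (inf_le_inf (eval_box_le hM hw) (eval_box_le hM hw)).trans (gimp_inf_le _ _)
  | kDia φ ψ =>
    rw [eval, gimp_eq_one, eval, eval_dia_le hM]
    intro w' hw
    exact sup_le_sup (le_eval_dia hM hw) (le_eval_dia hM hw)
  | fs1 φ ψ =>
    rw [eval, gimp_eq_one, eval_dia_le hM]
    intro w' hw
    rw [eval, eval, le_gimp_iff]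
    exact ((inf_le_inf_left _ (eval_box_le hM hw)).trans (gimp_inf_le _ _)).trans
      (le_eval_dia hM hw)
  | fs2 φ ψ =>
    rw [eval, gimp_eq_one, le_eval_box hM]
    intro w' hw
    rw [eval, eval, le_gimp_iff]
    exact ((inf_le_inf_left _ (le_eval_dia hM hw)).trans (gimp_inf_le _ _)).trans
      (eval_box_le hM hw)
  | fDia =>
    rw [Formula.neg, eval, gimp_eq_one, eval_dia_le hM]
    intro w' _
    rw [eval, eval]

theorem eval_gkcaxiom (hM : M.IsCrisp) {φ : Formula V} (h : GKcAxiom φ) (w : W) :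
    M.eval w φ = 1 := by
  cases h with
  | gk h => exact eval_gkaxiom hM h w
  | cr φ ψ =>
    rw [eval, gimp_eq_one]
    by_contra! hlt
    have h₁ : ¬ M.eval w (φ.or ψ).box ≤ M.eval w φ.box := fun h =>
      absurd (h.trans le_sup_left) (not_le.2 hlt)
    rw [le_eval_box hM] at h₁
    push Not at h₁
    obtain ⟨w', hw, h₂⟩ := h₁
    have h₃ : M.eval w' ψ ≤ M.eval w ψ.dia := le_eval_dia hM hw
    have h₄ : M.eval w (φ.or ψ).box ≤ M.eval w' φ ⊔ M.eval w' ψ := eval_box_le hM hw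
    exact absurd h₄ (not_le.2 (max_lt h₂ ((h₃.trans le_sup_right).trans_lt hlt)))

end Model

theorem Derivable.sound {Γ : Set (Formula V)} {φ : Formula V} (h : Derivable Γ φ)
    (hM : M.IsCrisp) (w : W) (hΓ : ∀ γ ∈ Γ, M.eval w γ = 1) : M.eval w φ = 1 := by
  induction h generalizing w with
  | hyp h => exact hΓ _ h
  | ax h => exact Model.eval_gkcaxiom hM h w
  | mp _ _ ih₁ ih₂ =>
    have h₂ := gimp_eq_one.1 (ih₂ w hΓ)
    rw [ih₁ w hΓ] at h₂
    exact le_antisymm unitInterval.le_one' h₂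
  | necBox _ ih =>
    refine le_antisymm unitInterval.le_one' ((Model.le_eval_box hM).2 fun w' _ => ?_)
    exact (ih w' (by simp)).ge
  | necDia _ ih =>
    rw [Model.eval, gimp_eq_one, Model.eval_dia_le hM]
    intro w' hw
    exact (gimp_eq_one.1 (ih w' (by simp))).trans (Model.le_eval_dia hM hw)

end Soundness

/-! ### Completeness -/

section Completeness

/-- A countable set `S` of worlds together with a countable dense chain `D` of truth values, in
which every value `v (□φ)` is the infimum relative to `D`, and every value `v (◇φ)` the supremum
relative to `D`, of the values of `φ` at the accessible worlds in `S`. -/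
structure IsWitnessed (S : Set (Formula V → HyperRat)) (D : Set HyperRat) : Prop where
  countable_worlds : S.Countable
  countable_values : D.Countable
  isWorld : ∀ v ∈ S, IsWorld v
  zero_mem : 0 ∈ D
  one_mem : 1 ∈ D
  bounds : ∀ d ∈ D, 0 ≤ d ∧ d ≤ 1
  dense : ∀ x ∈ D, ∀ y ∈ D, x < y → ∃ z ∈ D, x < z ∧ z < y
  mem : ∀ v ∈ S, ∀ φ, v φ ∈ D
  box : ∀ v ∈ S, ∀ φ, ∀ d ∈ D, v φ.box < d → ∃ w ∈ S, Accessible v w ∧ w φ < d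
  dia : ∀ v ∈ S, ∀ φ, ∀ d ∈ D, d < v φ.dia → ∃ w ∈ S, Accessible v w ∧ d < w φ

/-- Downward Löwenheim–Skolem: close a given world and the values `0` and `1` under intermediate
points, values and witnesses. -/
theorem exists_isWitnessed [Countable V] {v₀ : Formula V → HyperRat} (hv₀ : IsWorld v₀) :
    ∃ S D, v₀ ∈ S ∧ IsWitnessed S D := by
  classical
  have := countable_formula (V := V)
  have hmid : ∀ x y : HyperRat, ∃ z, x < y → x < z ∧ z < y := fun x y => by
    by_cases h : x < y
    · exact (exists_between h).imp fun _ hz _ => hz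
    · exact ⟨0, fun h' => absurd h' h⟩
  choose mid hmid using hmid
  have hbox : ∀ (v : {v : Formula V → HyperRat // IsWorld v}) (d : HyperRat) (φ : Formula V),
      ∃ w : {v : Formula V → HyperRat // IsWorld v},
        v.1 φ.box < d → d ≤ 1 → Accessible v.1 w.1 ∧ w.1 φ < d := fun v d φ => by
    by_cases h : v.1 φ.box < d ∧ d ≤ 1
    · obtain ⟨w, hw, h⟩ := v.2.exists_accessible_lt h.1 h.2
      exact ⟨⟨w, hw⟩, fun _ _ => h⟩
    · exact ⟨v, fun h₁ h₂ => absurd ⟨h₁, h₂⟩ h⟩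
  have hdia : ∀ (v : {v : Formula V → HyperRat // IsWorld v}) (d : HyperRat) (φ : Formula V),
      ∃ w : {v : Formula V → HyperRat // IsWorld v},
        d < v.1 φ.dia → 0 ≤ d → Accessible v.1 w.1 ∧ d < w.1 φ := fun v d φ => by
    by_cases h : d < v.1 φ.dia ∧ 0 ≤ d
    · obtain ⟨w, hw, h⟩ := v.2.exists_accessible_gt h.1 h.2
      exact ⟨⟨w, hw⟩, fun _ _ => h⟩
    · exact ⟨v, fun h₁ h₂ => absurd ⟨h₁, h₂⟩ h⟩
  choose bx hbx using hbox
  choose di hdi using hdia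
  let F : {v : Formula V → HyperRat // IsWorld v} ⊕ HyperRat →
      {v : Formula V → HyperRat // IsWorld v} ⊕ HyperRat →
      Set ({v : Formula V → HyperRat // IsWorld v} ⊕ HyperRat)
    | .inl v, .inl _ => Set.range fun φ => .inr (v.1 φ)
    | .inl v, .inr d => Set.range (fun φ => .inl (bx v d φ)) ∪ Set.range fun φ => .inl (di v d φ)
    | .inr _, .inl _ => ∅
    | .inr x, .inr y => {.inr (mid x y)}
  obtain ⟨t, hst, ht, hF⟩ := exists_countable_closure F (by
    rintro (v | x) (w | y)
    · exact Set.countable_range _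
    · exact (Set.countable_range _).union (Set.countable_range _)
    · exact Set.countable_empty
    · exact Set.countable_singleton _)
    (s := {.inl ⟨v₀, hv₀⟩, .inr 0, .inr 1}) (Set.toFinite _).countable
  refine ⟨(fun v => v.1) '' (Sum.inl ⁻¹' t), {d | .inr d ∈ t ∧ 0 ≤ d ∧ d ≤ 1},
    ⟨⟨v₀, hv₀⟩, hst (by simp), rfl⟩, ?_⟩
  constructor
  · exact (ht.preimage Sum.inl_injective).image _
  · exact (ht.preimage Sum.inr_injective).mono fun d hd => hd.1
  · rintro _ ⟨v, -, rfl⟩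
    exact v.2
  · exact ⟨hst (by simp), le_rfl, zero_le_one⟩
  · exact ⟨hst (by simp), zero_le_one, le_rfl⟩
  · exact fun d hd => hd.2
  · intro x hx y hy hxy
    have := hmid x y hxy
    exact ⟨mid x y, ⟨hF _ hx.1 _ hy.1 rfl, hx.2.1.trans this.1.le, this.2.le.trans hy.2.2⟩, this⟩
  · rintro _ ⟨v, hv, rfl⟩ φ
    exact ⟨hF _ hv _ hv ⟨φ, rfl⟩, v.2.nonneg φ, v.2.le_one φ⟩
  · rintro _ ⟨v, hv, rfl⟩ φ d hd hlt
    exact ⟨_, ⟨bx v d φ, hF _ hv _ hd.1 (.inl ⟨φ, rfl⟩), rfl⟩, hbx v d φ hlt hd.2.2⟩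
  · rintro _ ⟨v, hv, rfl⟩ φ d hd hlt
    exact ⟨_, ⟨di v d φ, hF _ hv _ hd.1 (.inr ⟨φ, rfl⟩), rfl⟩, hdi v d φ hlt hd.2.1⟩

open Classical in
/-- The crisp model over a family of hyperrational valuations, with values transported to `[0,1]`
along `ι`. -/
noncomputable def canonicalModel {W : Type v} (val : W → Formula V → HyperRat)
    (ι : HyperRat → unitInterval) : Model V W where
  R v w := if Accessible (val v) (val w) then 1 else 0
  e p w := ι (val w (.var p))

theorem isCrisp_canonicalModel {W : Type v} (val : W → Formula V → HyperRat)
    (ι : HyperRat → unitInterval) : (canonicalModel val ι).IsCrisp := by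
  intro v w
  by_cases h : Accessible (val v) (val w) <;> simp [canonicalModel, h]

theorem R_canonicalModel {W : Type v} {val : W → Formula V → HyperRat}
    {ι : HyperRat → unitInterval} {v w : W} :
    (canonicalModel val ι).R v w = 1 ↔ Accessible (val v) (val w) := by
  by_cases h : Accessible (val v) (val w) <;> simp [canonicalModel, h]

/-- The truth lemma. A failure at `□a` or `◇a` would leave room for the image of some `d ∈ D`, and an
accessible world with value of `a` beyond `d` refutes it. -/
theorem eval_canonicalModel {S : Set (Formula V → HyperRat)} {D : Set HyperRat}
    (hS : IsWitnessed S D) {ι : HyperRat → unitInterval} (hι : StrictMonoOn ι D) (h0 : ι 0 = 0)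
    (h1 : ι 1 = 1) (hdense : ∀ x y : unitInterval, x < y → ∃ d ∈ D, x < ι d ∧ ι d < y)
    {W : Type v} {val : W → Formula V → HyperRat} (hval : Set.range val = S) (φ : Formula V) :
    ∀ w, (canonicalModel val ι).eval w φ = ι (val w φ) := by
  have hmem : ∀ w, val w ∈ S := fun w => hval ▸ ⟨w, rfl⟩
  have hD : ∀ w φ, val w φ ∈ D := fun w φ => hS.mem _ (hmem w) φ
  have hW := fun w => hS.isWorld _ (hmem w)
  have hcrisp := isCrisp_canonicalModel val ι
  induction φ with
  | var p => exact fun w => rfl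
  | bot => intro w; rw [(hW w).bot, h0, Model.eval]
  | and a b iha ihb =>
    intro w
    rw [Model.eval, iha, ihb, (hW w).and]
    exact (hι.monotoneOn.map_inf (hD w a) (hD w b)).symm
  | or a b iha ihb =>
    intro w
    rw [Model.eval, iha, ihb, (hW w).or]
    exact (hι.monotoneOn.map_sup (hD w a) (hD w b)).symm
  | imp a b iha ihb =>
    intro w
    rw [Model.eval, iha, ihb, (hW w).imp, gimp]
    by_cases h : val w a ≤ val w b <;> simp [h, h1, hι.le_iff_le (hD w a) (hD w b)]
  | box a ih =>
    intro w
    refine le_antisymm ?_ ((Model.le_eval_box hcrisp).2 fun w' hw => ?_)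
    · by_contra! hlt
      obtain ⟨d, hd, h₁, h₂⟩ := hdense _ _ hlt
      obtain ⟨u, hu, hacc, h₃⟩ := hS.box _ (hmem w) a d hd ((hι.lt_iff_lt (hD w _) hd).1 h₁)
      rw [← hval] at hu
      obtain ⟨w', rfl⟩ := hu
      have h₄ := Model.eval_box_le hcrisp (φ := a) (R_canonicalModel.2 hacc)
      rw [ih] at h₄
      exact absurd (h₂.trans_le h₄) (not_lt.2 (hι (hD w' a) hd h₃).le)
    · rw [ih]
      exact hι.monotoneOn (hD _ _) (hD _ _) (R_canonicalModel.1 hw a).1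
  | dia a ih =>
    intro w
    refine le_antisymm ((Model.eval_dia_le hcrisp).2 fun w' hw => ?_) ?_
    · rw [ih]
      exact hι.monotoneOn (hD _ _) (hD _ _) (R_canonicalModel.1 hw a).2
    · by_contra! hlt
      obtain ⟨d, hd, h₁, h₂⟩ := hdense _ _ hlt
      obtain ⟨u, hu, hacc, h₃⟩ := hS.dia _ (hmem w) a d hd ((hι.lt_iff_lt hd (hD w _)).1 h₂)
      rw [← hval] at hu
      obtain ⟨w', rfl⟩ := hu
      have h₄ := Model.le_eval_dia hcrisp (φ := a) (R_canonicalModel.2 hacc)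
      rw [ih] at h₄
      exact absurd (h₄.trans_lt h₁) (not_lt.2 (hι hd (hD w' a) h₃).le)

theorem LocalConsequence.derivable [Countable V] {Γ : Set (Formula V)} {φ : Formula V}
    (h : LocalConsequence.{u, v} Γ φ) : Derivable Γ φ := by
  by_contra hn
  obtain ⟨v₀, hv₀, hΓ, hφ⟩ := exists_isWorld_of_not_derivable hn
  obtain ⟨S, D, hv₀S, hS⟩ := exists_isWitnessed hv₀
  obtain ⟨ι, hι, h0, h1, hdense⟩ := exists_dense_embedding hS.countable_values zero_lt_one
    hS.zero_mem hS.one_mem hS.bounds hS.dense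
  -- Countably many worlds fit into every universe.
  have : Countable S := hS.countable_worlds.to_subtype
  have : Small.{v} S := Countable.toSmall S
  let val : Shrink.{v} S → Formula V → HyperRat := fun w => ((equivShrink.{v} S).symm w : S)
  have hval : Set.range val = S := by
    rw [show val = Subtype.val ∘ (equivShrink.{v} S).symm from rfl,
      (equivShrink.{v} S).symm.surjective.range_comp, Subtype.range_coe]
  have heval := eval_canonicalModel hS hι h0 h1 hdense hval
  let w₀ : Shrink.{v} S := equivShrink.{v} S ⟨v₀, hv₀S⟩
  have hw₀ : val w₀ = v₀ := by simp [val, w₀]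
  have : Nonempty (Shrink.{v} S) := ⟨w₀⟩
  have h₁ := h _ (canonicalModel val ι) (isCrisp_canonicalModel val ι) w₀ fun γ hγ => by
    rw [heval, hw₀, hΓ γ hγ, h1]
  rw [heval, hw₀] at h₁
  exact (hι (hS.mem v₀ hv₀S φ) hS.one_mem hφ).ne (h₁.trans h1.symm)

end Completeness

end GodelModal

theorem mainTheorem1 {V : Type u} [Countable V]
    (Γ : Set (GodelModal.Formula V)) (φ : GodelModal.Formula V) :
    GodelModal.Derivable Γ φ ↔ GodelModal.LocalConsequence.{u, v} Γ φ :=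
  ⟨fun h _ _ _ hM w hΓ => h.sound hM w hΓ, fun h => h.derivable⟩
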